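/- Let $\mathbb{K}$ be an algebraically closed field and let $V$ be a vector space over $\mathbb{K}$ of finite positive dimension. An eigenspace of $A\in\mathrm{End}(V)$ is a nonzero subspace of the form $\{v\in V: Av=\theta v\}$ with $\theta\in\mathbb{K}$, and $A$ is diagonalizable if $V$ is spanned by its eigenspaces. An ordering $\{V_i\}_{i=0}^d$ of the eigenspaces of $A$ is called standard with respect to $C\in\mathrm{End}(V)$ if $CV_i\subseteq V_{i-1}+V_i+V_{i+1}$ for $0\le i\le d$, where $V_{-1}=V_{d+1}=0$. A tridiagonal pair on $V$ is an ordered pair $A,A^*\in\mathrm{End}(V)$ of diagonalizable maps (here $A^*$ is just a second map) such that the eigenspaces of $A$ have an ordering that is standard with respect to $A^*$, the eigenspaces of $A^*$ have an ordering that is standard with respect to $A$, and there is no subspace $W$ with $AW\subseteq W$, $A^*W\subseteq W$, $W\ne 0$, $W\ne V$. A tridiagonal system of diameter $d$ on $V$ is a sequence $\Phi=(A;\{E_i\}_{i=0}^d;A^*;\{E_i^*\}_{i=0}^d)$ such that $A,A^*$ is a tridiagonal pair, $\{E_i\}$ (resp. $\{E_i^*\}$) are the projections onto the eigenspaces of $A$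 (resp. $A^*$) along the sum of the other eigenspaces, and the orderings $\{E_iV\}$ of the eigenspaces of $A$ and $\{E_i^*V\}$ of the eigenspaces of $A^*$ are standard with respect to $A^*$ and $A$, respectively. Let $\Phi$ be a tridiagonal system on $V$ of diameter $d\ge 1$ and of $q$-Racah type: let $q,a,b\in\mathbb{K}$ be nonzero scalars with $q^4\ne 1$ such that for $0\le i\le d$ the eigenvalue of $A$ on $E_iV$ is $\theta_i=aq^{d-2i}+a^{-1}q^{2i-d}$ and the eigenvalue of $A^*$ on $E_i^*V$ is $\theta^*_i=bq^{d-2i}+b^{-1}q^{2i-d}$. For $0\le i\le d$ put $$U_i=(E_0^*V+\cdots+E_i^*V)\cap(E_iV+\cdots+E_dV),\qquad U_i^{\Downarrow}=(E_0^*V+\cdots+E_i^*V)\cap(E_0V+\cdots+E_{d-i}V).$$ Then there is a unique $K\in\mathrm{End}(V)$ with $(K-q^{d-2i}I)U_i=0$ for $0\le i\le d$, and a unique $B\in\mathrm{End}(V)$ with $(B-q^{d-2i}I)U_i^{\Downarrow}=0$ for $0\le i\le d$. Both $K$ and $B$ are invertible, and $$aB^{-2}-\frac{a^{-1}q-aq^{-1}}{q-q^{-1}}\,K^{-1}B^{-1}-\frac{aq-a^{-1}q^{-1}}{q-q^{-1}}\,B^{-1}K^{-1}+a^{-1}K^{-2}=0.$$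 -/

import Mathlib

open Module

section TridiagonalPairs

variable {𝕂 V : Type*} [Field 𝕂] [AddCommGroup V] [Module 𝕂 V]

/-- `W` is an eigenspace of `A`: it is nonzero and equal to `{v | A v = θ v}` for some scalar `θ`. -/
def IsEigenspace (A : End 𝕂 V) (W : Submodule 𝕂 V) : Prop :=
  W ≠ ⊥ ∧ ∃ θ : 𝕂, W = A.eigenspace θ

/-- `A` is diagonalizable: `V` is spanned by the eigenspaces of `A`. -/
def IsDiagonalizableEnd (A : End 𝕂 V) : Prop :=
  sSup {W | IsEigenspace A W} = ⊤

/-- `W 0, …, W d` lists the eigenspaces of `A`, each exactly once. -/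
def IsEigenspaceOrdering {d : ℕ} (A : End 𝕂 V) (W : Fin (d + 1) → Submodule 𝕂 V) : Prop :=
  Function.Injective W ∧ Set.range W = {X | IsEigenspace A X}

/-- `W 0, …, W d` is a standard ordering of the eigenspaces of `A` with respect to `C`:
`C (W i) ⊆ W (i-1) + W i + W (i+1)` for `0 ≤ i ≤ d`, where `W (-1) = W (d+1) = 0`
(so the sum runs over the indices `j` in `{0, …, d}` with `|i - j| ≤ 1`). -/
def IsStandardOrdering {d : ℕ} (A C : End 𝕂 V) (W : Fin (d + 1) → Submodule 𝕂 V) : Prop :=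
  IsEigenspaceOrdering A W ∧
    ∀ i : Fin (d + 1), (W i).map C ≤
      ⨆ j : Fin (d + 1), ⨆ _ : (j : ℕ) ≤ (i : ℕ) + 1 ∧ (i : ℕ) ≤ (j : ℕ) + 1, W j

/-- A tridiagonal pair on `V` (here `A'` plays the role of `A^*`). -/
structure IsTDPair (A A' : End 𝕂 V) : Prop where
  diagonalizable : IsDiagonalizableEnd A
  diagonalizable' : IsDiagonalizableEnd A'
  tridiagonal : ∃ (d : ℕ) (W : Fin (d + 1) → Submodule 𝕂 V), IsStandardOrdering A A' W
  tridiagonal' : ∃ (δ : ℕ) (W : Fin (δ + 1) → Submodule 𝕂 V), IsStandardOrdering A' A W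
  irreducible : ¬ ∃ W : Submodule 𝕂 V, W.map A ≤ W ∧ W.map A' ≤ W ∧ W ≠ ⊥ ∧ W ≠ ⊤

/-- `E 0, …, E d` is an ordering of the primitive idempotents of the (diagonalizable) map `A`:
the images `E i V` list the eigenspaces of `A`, and `E i` is the identity on `E i V` and zero
on `E j V` for `j ≠ i`. -/
structure IsPrimitiveIdempotentOrdering {d : ℕ} (A : End 𝕂 V) (E : Fin (d + 1) → End 𝕂 V) :
    Prop where
  ordering : IsEigenspaceOrdering A (fun i => LinearMap.range (E i))
  apply_self : ∀ i, ∀ v ∈ LinearMap.range (E i), E i v = v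
  apply_ne : ∀ i j, j ≠ i → ∀ v ∈ LinearMap.range (E j), E i v = 0

/-- A tridiagonal system `(A; {E i}; A'; {E' i})` of diameter `d` on `V`. -/
structure IsTDSystem {d : ℕ} (A : End 𝕂 V) (E : Fin (d + 1) → End 𝕂 V)
    (A' : End 𝕂 V) (E' : Fin (d + 1) → End 𝕂 V) : Prop where
  pair : IsTDPair A A'
  idempotents : IsPrimitiveIdempotentOrdering A E
  standard : IsStandardOrdering A A' (fun i => LinearMap.range (E i))
  idempotents' : IsPrimitiveIdempotentOrdering A' E'
  standard' : IsStandardOrdering A' A (fun i => LinearMap.range (E' i))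

/-- `θ 0, …, θ d` is the eigenvalue sequence of `A` for the ordering `E 0, …, E d` of its
primitive idempotents: `E i V` is the eigenspace of `A` with eigenvalue `θ i`. -/
def IsEigenvalueSequence {d : ℕ} (A : End 𝕂 V) (E : Fin (d + 1) → End 𝕂 V)
    (θ : Fin (d + 1) → 𝕂) : Prop :=
  ∀ i, LinearMap.range (E i) = A.eigenspace (θ i)

/-- The tridiagonal system has `q`-Racah type, with parameters `q, a, b`. -/
structure IsQRacahType {d : ℕ} (A : End 𝕂 V) (E : Fin (d + 1) → End 𝕂 V)
    (A' : End 𝕂 V) (E' : Fin (d + 1) → End 𝕂 V) (q a b : 𝕂) : Prop where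
  q_ne_zero : q ≠ 0
  a_ne_zero : a ≠ 0
  b_ne_zero : b ≠ 0
  q_pow_four_ne_one : q ^ 4 ≠ 1
  eigenvalues : IsEigenvalueSequence A E
    (fun i => a * q ^ ((d : ℤ) - 2 * (i : ℕ)) + a⁻¹ * q ^ (2 * ((i : ℕ) : ℤ) - d))
  eigenvalues' : IsEigenvalueSequence A' E'
    (fun i => b * q ^ ((d : ℤ) - 2 * (i : ℕ)) + b⁻¹ * q ^ (2 * ((i : ℕ) : ℤ) - d))

/-- The first split decomposition:
`U i = (E' 0 V + ⋯ + E' i V) ∩ (E i V + ⋯ + E d V)`. -/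
def firstSplit {d : ℕ} (E E' : Fin (d + 1) → End 𝕂 V) (i : Fin (d + 1)) : Submodule 𝕂 V :=
  (⨆ j : Fin (d + 1), ⨆ _ : j ≤ i, LinearMap.range (E' j)) ⊓
    (⨆ j : Fin (d + 1), ⨆ _ : i ≤ j, LinearMap.range (E j))

/-- The second split decomposition:
`U⇓ i = (E' 0 V + ⋯ + E' i V) ∩ (E 0 V + ⋯ + E (d-i) V)`. -/
def secondSplit {d : ℕ} (E E' : Fin (d + 1) → End 𝕂 V) (i : Fin (d + 1)) : Submodule 𝕂 V :=
  (⨆ j : Fin (d + 1), ⨆ _ : j ≤ i, LinearMap.range (E' j)) ⊓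
    (⨆ j : Fin (d + 1), ⨆ _ : (j : ℕ) + (i : ℕ) ≤ d, LinearMap.range (E j))

/-- `(X - q^(d-2i) I) (U i) = 0` for `0 ≤ i ≤ d`. When `U` is a decomposition of `V`, this
determines the map `X`: it is `K` for the first split decomposition and `B` for the second. -/
def ActsByWeights {d : ℕ} (q : 𝕂) (U : Fin (d + 1) → Submodule 𝕂 V) (X : End 𝕂 V) : Prop :=
  ∀ i, ∀ v ∈ U i, (X - q ^ ((d : ℤ) - 2 * (i : ℕ)) • (1 : End 𝕂 V)) v = 0

end TridiagonalPairs

/-!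
Write `X n` for the sum of the first `n` eigenspaces of `A'`. Intersecting this flag with the
two flags of sums of consecutive eigenspaces of `A` gives the two split decompositions `U` and
`U⇓`; both are direct by irreducibility (`IsSplitFlagPair.disjoint`,
`IsSplitFlagPair.iSup_splitPart`), so `K` and `B` exist, are unique and have inverses `k` and
`β`. On `U` the map `A` is the sum of the diagonal map `a K + a⁻¹ k` and a raising map `R`, and
similarly for `U⇓` with `a⁻¹` in place of `a`. This yields relations of `q`-Weyl type between
`A` and `k`, and between `A` and `β` (`IsSplitFlagPair.weyl_relation`).

Let `M` be the quadratic expression in `k` and `β` that has to vanish. Purely formally, those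
relations imply `A M - q⁻⁴ M A = P M + M Q` with `P` and `Q` linear combinations of `k` and `β`
(`exists_intertwining`; this needs `a² ≠ 1`, which holds since the first and last eigenvalues of
`A` differ). As `k` and `β` preserve the flag `X`, on the associated graded space `M` commutes
with `R` up to the scalar `q⁻⁴`. Moreover `M` lowers the flag by one step, because `k` and `β`
act as the same scalar on `X (n + 1) / X n`.

The raising map behaves as in a representation of `sl₂`: the power `R ^ (d - 2 j)` is a
bijection from the `j`-th to the `(d - j)`-th component. It is injective because a vector in its
kernel lies in the sum of the eigenspaces of `A` with index less than `d - j` and in `X (j +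
1)`, which meet trivially by the second split decomposition; it is surjective by a dimension
count. Hence every component consists, modulo the image of `R`, of vectors of lowest weight. If
`M` lowers `X` by `r ≥ 1` steps, the image of a lowest weight vector is killed by a power of `R`
that is injective in its degree, so `M` lowers `X` by `r + 1` steps
(`IsSplitFlagPair.lowering_succ`). By induction `M = 0`.
-/

section SplitDecompositions

variable {𝕂 V : Type*} [Field 𝕂] [AddCommGroup V] [Module 𝕂 V]

/-! ### Flags of eigenspaces -/

/-- The sum of the members of `W` with index less than `n`. -/
def lowerFlag {d : ℕ} (W : Fin (d + 1) → Submodule 𝕂 V) (n : ℕ) : Submodule 𝕂 V :=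
  ⨆ j : Fin (d + 1), ⨆ _ : (j : ℕ) < n, W j

/-- The sum of the members of `W` with index at least `n`. -/
def upperFlag {d : ℕ} (W : Fin (d + 1) → Submodule 𝕂 V) (n : ℕ) : Submodule 𝕂 V :=
  ⨆ j : Fin (d + 1), ⨆ _ : n ≤ (j : ℕ), W j

variable {d : ℕ} {W : Fin (d + 1) → Submodule 𝕂 V}

theorem le_lowerFlag {j : Fin (d + 1)} {n : ℕ} (h : (j : ℕ) < n) : W j ≤ lowerFlag W n :=
  le_iSup₂_of_le j h le_rfl

theorem le_upperFlag {j : Fin (d + 1)} {n : ℕ} (h : n ≤ (j : ℕ)) : W j ≤ upperFlag W n :=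
  le_iSup₂_of_le j h le_rfl

theorem lowerFlag_mono : Monotone (lowerFlag W) := fun _ _ h =>
  iSup₂_le fun _ hj => le_lowerFlag (hj.trans_le h)

theorem upperFlag_anti : Antitone (upperFlag W) := fun _ _ h =>
  iSup₂_le fun _ hj => le_upperFlag (h.trans hj)

theorem lowerFlag_zero : lowerFlag W 0 = ⊥ := by simp [lowerFlag]

theorem upperFlag_of_lt {n : ℕ} (hn : d < n) : upperFlag W n = ⊥ := by
  refine le_bot_iff.1 (iSup₂_le fun j hj => ?_)
  omega

theorem lowerFlag_of_lt {n : ℕ} (hn : d < n) : lowerFlag W n = ⨆ j, W j :=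
  le_antisymm (iSup₂_le fun j _ => le_iSup W j) (iSup_le fun _ => le_lowerFlag (by omega))

theorem upperFlag_zero : upperFlag W 0 = ⨆ j, W j :=
  le_antisymm (iSup₂_le fun j _ => le_iSup W j) (iSup_le fun _ => le_upperFlag (Nat.zero_le _))

theorem isCompl_lowerFlag_upperFlag (hind : iSupIndep W) (htop : ⨆ j, W j = ⊤) (n : ℕ) :
    IsCompl (lowerFlag W n) (upperFlag W n) := by
  constructor
  · have h : Disjoint {j : Fin (d + 1) | (j : ℕ) < n} {j : Fin (d + 1) | n ≤ (j : ℕ)} :=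
      Set.disjoint_left.2 fun j (h1 : (j : ℕ) < n) (h2 : n ≤ (j : ℕ)) => by omega
    exact hind.disjoint_biSup_biSup h
  · rw [codisjoint_iff, eq_top_iff, ← htop]
    refine iSup_le fun j => ?_
    rcases lt_or_ge (j : ℕ) n with h | h
    · exact (le_lowerFlag h).trans le_sup_left
    · exact (le_upperFlag h).trans le_sup_right

theorem apply_mem_of_mem_lowerFlag {f : End 𝕂 V} {n : ℕ} {S : Submodule 𝕂 V}
    (h : ∀ j : Fin (d + 1), (j : ℕ) < n → ∀ v ∈ W j, f v ∈ S) {v : V} (hv : v ∈ lowerFlag W n) :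
    f v ∈ S :=
  (iSup₂_le fun j hj => h j hj : lowerFlag W n ≤ S.comap f) hv

theorem apply_mem_of_mem_upperFlag {f : End 𝕂 V} {n : ℕ} {S : Submodule 𝕂 V}
    (h : ∀ j : Fin (d + 1), n ≤ (j : ℕ) → ∀ v ∈ W j, f v ∈ S) {v : V} (hv : v ∈ upperFlag W n) :
    f v ∈ S :=
  (iSup₂_le fun j hj => h j hj : upperFlag W n ≤ S.comap f) hv

/-! ### Diagonalizable maps and tridiagonal action on flags -/

/-- `W` is a direct sum decomposition of `V` such that `A` acts on `W i` as `θ i`, with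
`W i` the full eigenspace, and such that `C` acts on `W` in a block tridiagonal way. The sequence
`θ` is defined on all of `ℕ`, but only its values at `0, …, d` matter. -/
structure IsTridiagonalDecomposition (A C : End 𝕂 V) (θ : ℕ → 𝕂)
    (W : Fin (d + 1) → Submodule 𝕂 V) : Prop where
  indep : iSupIndep W
  iSup_eq_top : ⨆ j, W j = ⊤
  ne_bot : ∀ j, W j ≠ ⊥
  eq_eigenspace : ∀ j, W j = A.eigenspace (θ j)
  tridiagonal : ∀ i : Fin (d + 1), (W i).map C ≤
      ⨆ j : Fin (d + 1), ⨆ _ : (j : ℕ) ≤ (i : ℕ) + 1 ∧ (i : ℕ) ≤ (j : ℕ) + 1, W j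

theorem IsStandardOrdering.isTridiagonalDecomposition {A C : End 𝕂 V} {θ : ℕ → 𝕂}
    (h : IsStandardOrdering A C W) (hA : IsDiagonalizableEnd A)
    (hθ : ∀ j : Fin (d + 1), W j = A.eigenspace (θ j)) : IsTridiagonalDecomposition A C θ W := by
  have hθinj : Function.Injective fun j : Fin (d + 1) => θ j := fun i j hij =>
    h.1.1 (by rw [hθ, hθ, show θ i = θ j from hij])
  refine ⟨?_, ?_, fun j => ?_, hθ, h.2⟩
  · rw [show W = (fun μ => A.eigenspace μ) ∘ (fun j : Fin (d + 1) => θ j) from funext hθ]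
    exact (Module.End.eigenspaces_iSupIndep A).comp hθinj
  · rw [IsDiagonalizableEnd] at hA
    rw [← hA, ← h.1.2, sSup_range]
  · have : W j ∈ Set.range W := ⟨j, rfl⟩
    rw [h.1.2] at this
    exact this.1

namespace IsTridiagonalDecomposition

variable {A C : End 𝕂 V} {θ : ℕ → 𝕂}

theorem apply_of_mem (h : IsTridiagonalDecomposition A C θ W) {j : Fin (d + 1)} {v : V}
    (hv : v ∈ W j) : A v = θ j • v := by
  rw [h.eq_eigenspace] at hv
  exact Module.End.mem_eigenspace_iff.1 hv

theorem isCompl (h : IsTridiagonalDecomposition A C θ W) (n : ℕ) :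
    IsCompl (lowerFlag W n) (upperFlag W n) :=
  isCompl_lowerFlag_upperFlag h.indep h.iSup_eq_top n

theorem apply_sub_smul_mem_lowerFlag (h : IsTridiagonalDecomposition A C θ W) {n : ℕ} {v : V}
    (hv : v ∈ lowerFlag W (n + 1)) : A v - θ n • v ∈ lowerFlag W n := by
  change (A - θ n • (1 : End 𝕂 V)) v ∈ _
  refine apply_mem_of_mem_lowerFlag (fun j hj v hv => ?_) hv
  simp only [LinearMap.sub_apply, LinearMap.smul_apply, Module.End.one_apply, h.apply_of_mem hv,
    ← sub_smul]
  rcases (Nat.lt_succ_iff_lt_or_eq.1 hj) with hj | hj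
  · exact Submodule.smul_mem _ _ (le_lowerFlag hj hv)
  · simp [hj]

theorem apply_sub_smul_mem_upperFlag (h : IsTridiagonalDecomposition A C θ W) {n : ℕ} {v : V}
    (hv : v ∈ upperFlag W n) : A v - θ n • v ∈ upperFlag W (n + 1) := by
  change (A - θ n • (1 : End 𝕂 V)) v ∈ _
  refine apply_mem_of_mem_upperFlag (fun j hj v hv => ?_) hv
  simp only [LinearMap.sub_apply, LinearMap.smul_apply, Module.End.one_apply, h.apply_of_mem hv,
    ← sub_smul]
  rcases hj.lt_or_eq with hj | hj
  · exact Submodule.smul_mem _ _ (le_upperFlag hj hv)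
  · simp [hj]

theorem map_lowerFlag (h : IsTridiagonalDecomposition A C θ W) {n : ℕ} {v : V}
    (hv : v ∈ lowerFlag W n) : C v ∈ lowerFlag W (n + 1) := by
  refine apply_mem_of_mem_lowerFlag (fun j hj v hv => ?_) hv
  refine (iSup₂_le fun i hi => le_lowerFlag ?_ :
    (⨆ i : Fin (d + 1), ⨆ _ : (i : ℕ) ≤ (j : ℕ) + 1 ∧ (j : ℕ) ≤ (i : ℕ) + 1, W i) ≤ _)
    (h.tridiagonal j (Submodule.mem_map_of_mem hv))
  omega

theorem map_upperFlag (h : IsTridiagonalDecomposition A C θ W) {n : ℕ} {v : V}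
    (hv : v ∈ upperFlag W (n + 1)) : C v ∈ upperFlag W n := by
  refine apply_mem_of_mem_upperFlag (fun j hj v hv => ?_) hv
  refine (iSup₂_le fun i hi => le_upperFlag ?_ :
    (⨆ i : Fin (d + 1), ⨆ _ : (i : ℕ) ≤ (j : ℕ) + 1 ∧ (j : ℕ) ≤ (i : ℕ) + 1, W i) ≤ _)
    (h.tridiagonal j (Submodule.mem_map_of_mem hv))
  omega

/-- `A - θ j` is invertible on the sum of the eigenspaces of index at least `n > j`, so
membership in the lower flag can be tested after applying it. -/
theorem mem_lowerFlag_of_apply_sub_smul_mem (h : IsTridiagonalDecomposition A C θ W) {j n : ℕ}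
    (hjn : j < n) {v : V} (hv : A v - θ j • v ∈ lowerFlag W n) : v ∈ lowerFlag W n := by
  rcases lt_or_ge d j with hd | hd
  · rw [lowerFlag_of_lt (hd.trans hjn), h.iSup_eq_top]
    trivial
  have hlow : ∀ w ∈ lowerFlag W n, A w - θ j • w ∈ lowerFlag W n := fun w hw => by
    refine sub_mem (apply_mem_of_mem_lowerFlag (fun i hi u hu => ?_) hw)
      (Submodule.smul_mem _ _ hw)
    rw [h.apply_of_mem hu]
    exact Submodule.smul_mem _ _ (le_lowerFlag hi hu)
  have hup : ∀ w ∈ upperFlag W n, A w - θ j • w ∈ upperFlag W n := fun w hw => by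
    refine sub_mem (apply_mem_of_mem_upperFlag (fun i hi u hu => ?_) hw)
      (Submodule.smul_mem _ _ hw)
    rw [h.apply_of_mem hu]
    exact Submodule.smul_mem _ _ (le_upperFlag hi hu)
  have hvm : v ∈ lowerFlag W n ⊔ upperFlag W n := by
    rw [(h.isCompl n).sup_eq_top]; trivial
  obtain ⟨x, hx, y, hy, rfl⟩ := Submodule.mem_sup.1 hvm
  have hy0 : A y - θ j • y = 0 := by
    refine Submodule.disjoint_def.1 (h.isCompl n).disjoint _ ?_ (hup y hy)
    have := sub_mem hv (hlow x hx)
    rwa [map_add, smul_add, add_sub_add_comm, add_sub_cancel_left] at this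
  refine add_mem hx (le_lowerFlag (W := W) (j := ⟨j, by omega⟩) hjn ?_)
  rw [h.eq_eigenspace]
  exact Module.End.mem_eigenspace_iff.2 (sub_eq_zero.1 hy0)

end IsTridiagonalDecomposition

/-! ### Split decompositions -/

/-- An increasing flag `X` and a decreasing flag `Y`, of length `d + 1`, and an irreducible pair of
maps `A, C` such that `A` maps `X n` into `X (n + 1)` and `C` maps `Y (n + 1)` into `Y n`, while on
successive quotients `A` acts on `Y` as `θ` and `C` acts on `X` as `φ`. The member `X n` has the
role of a sum of `n` eigenspaces of `C`. -/
structure IsSplitFlagPair (d : ℕ) (A C : End 𝕂 V) (θ φ : ℕ → 𝕂)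
    (X Y : ℕ → Submodule 𝕂 V) : Prop where
  X_mono : Monotone X
  X_zero : X 0 = ⊥
  X_top : X (d + 1) = ⊤
  X_ne_bot : X 1 ≠ ⊥
  X_ne_top : X d ≠ ⊤
  Y_anti : Antitone Y
  Y_zero : Y 0 = ⊤
  Y_bot : Y (d + 1) = ⊥
  A_X : ∀ n, ∀ v ∈ X n, A v ∈ X (n + 1)
  A_Y : ∀ n, ∀ v ∈ Y n, A v - θ n • v ∈ Y (n + 1)
  C_X : ∀ n, ∀ v ∈ X (n + 1), C v - φ n • v ∈ X n
  C_Y : ∀ n, ∀ v ∈ Y (n + 1), C v ∈ Y n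
  irreducible : ¬ ∃ W : Submodule 𝕂 V, W.map A ≤ W ∧ W.map C ≤ W ∧ W ≠ ⊥ ∧ W ≠ ⊤

/-- The `n`-th component of the decomposition split by the flags `X` and `Y`. -/
def splitPart (X Y : ℕ → Submodule 𝕂 V) (n : ℕ) : Submodule 𝕂 V := X (n + 1) ⊓ Y n

namespace IsSplitFlagPair

variable {d : ℕ} {A C : End 𝕂 V} {θ φ : ℕ → 𝕂} {X Y : ℕ → Submodule 𝕂 V}

/-- If the subspaces `S n` are shifted up by `A` and down by `C`, modulo scalars, then their sum is
invariant, hence trivial by irreducibility. -/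
theorem eq_bot_or_eq_top (h : IsSplitFlagPair d A C θ φ X Y) {S : ℕ → Submodule 𝕂 V}
    (hA : ∀ n, ∀ v ∈ S n, A v - θ n • v ∈ S (n + 1))
    (hC0 : ∀ v ∈ S 0, C v ∈ S 0)
    (hC : ∀ n, ∀ v ∈ S (n + 1), ∃ c : 𝕂, C v - c • v ∈ S n) :
    ⨆ n, S n = ⊥ ∨ ⨆ n, S n = ⊤ := by
  by_contra hne
  rw [not_or] at hne
  refine h.irreducible ⟨⨆ n, S n, ?_, ?_, hne.1, hne.2⟩
  · refine Submodule.map_le_iff_le_comap.2 (iSup_le fun n v hv => ?_)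
    have := add_mem (le_iSup S _ (hA n v hv)) (Submodule.smul_mem _ (θ n) (le_iSup S _ hv))
    rwa [sub_add_cancel] at this
  · refine Submodule.map_le_iff_le_comap.2 (iSup_le fun n v hv => ?_)
    cases n with
    | zero => exact le_iSup S _ (hC0 v hv)
    | succ n =>
      obtain ⟨c, hc⟩ := hC n v hv
      have := add_mem (le_iSup S _ hc) (Submodule.smul_mem _ c (le_iSup S _ hv))
      rwa [sub_add_cancel] at this

theorem sub_smul_mem_Y (h : IsSplitFlagPair d A C θ φ X Y) (c : 𝕂) {n : ℕ} {v : V}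
    (hv : v ∈ Y (n + 1)) : C v - c • v ∈ Y n :=
  sub_mem (h.C_Y n v hv) (Submodule.smul_mem _ _ (h.Y_anti n.le_succ hv))

theorem sub_smul_mem_X (h : IsSplitFlagPair d A C θ φ X Y) (c : 𝕂) {n : ℕ} {v : V}
    (hv : v ∈ X n) : A v - c • v ∈ X (n + 1) :=
  sub_mem (h.A_X n v hv) (Submodule.smul_mem _ _ (h.X_mono n.le_succ hv))

/-- The sum of all `X n ⊓ Y n` is invariant and contained in the proper subspace `X d`. -/
theorem disjoint (h : IsSplitFlagPair d A C θ φ X Y) (n : ℕ) : Disjoint (X n) (Y n) := by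
  have hle : ⨆ n, X n ⊓ Y n ≤ X d := iSup_le fun n => by
    rcases le_or_gt n d with hn | hn
    · exact inf_le_left.trans (h.X_mono hn)
    · exact (inf_le_right.trans (h.Y_anti hn)).trans (h.Y_bot.le.trans bot_le)
  rcases h.eq_bot_or_eq_top (S := fun n => X n ⊓ Y n)
    (fun n v hv => ⟨h.sub_smul_mem_X _ hv.1, h.A_Y n v hv.2⟩)
    (fun v hv => by
      have hv0 : v = 0 := by simpa [h.X_zero] using hv.1
      simp [hv0])
    (fun n v hv => ⟨φ n, h.C_X n v hv.1, h.sub_smul_mem_Y _ hv.2⟩) with h0 | h1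
  · rw [disjoint_iff, eq_bot_iff, ← h0]
    exact le_iSup (fun n => X n ⊓ Y n) n
  · exact absurd (top_le_iff.1 (h1.symm.le.trans hle)) h.X_ne_top

/-- The sum of the components is invariant and contains `X 1 ≠ ⊥`. -/
theorem iSup_splitPart (h : IsSplitFlagPair d A C θ φ X Y) : ⨆ n, splitPart X Y n = ⊤ := by
  rcases h.eq_bot_or_eq_top (S := splitPart X Y)
    (fun n v hv => ⟨h.sub_smul_mem_X _ hv.1, h.A_Y n v hv.2⟩)
    (fun v hv => by
      refine ⟨?_, by rw [h.Y_zero]; trivial⟩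
      have h0 : C v = φ 0 • v := by
        have := h.C_X 0 v hv.1
        rw [h.X_zero, Submodule.mem_bot] at this
        exact sub_eq_zero.1 this
      rw [h0]
      exact Submodule.smul_mem _ _ hv.1)
    (fun n v hv => ⟨φ (n + 1), h.C_X _ v hv.1, h.sub_smul_mem_Y _ hv.2⟩) with h0 | h1
  · refine absurd (le_bot_iff.1 ?_) h.X_ne_bot
    rw [← h0]
    refine le_trans ?_ (le_iSup _ 0)
    simp [splitPart, h.Y_zero]
  · exact h1

theorem isCompl (h : IsSplitFlagPair d A C θ φ X Y) (n : ℕ) : IsCompl (X n) (Y n) := by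
  refine ⟨h.disjoint n, ?_⟩
  rw [codisjoint_iff, eq_top_iff, ← h.iSup_splitPart]
  refine iSup_le fun m => ?_
  rcases lt_or_ge m n with hm | hm
  · exact (inf_le_left.trans (h.X_mono hm)).trans le_sup_left
  · exact (inf_le_right.trans (h.Y_anti hm)).trans le_sup_right

theorem exists_add (h : IsSplitFlagPair d A C θ φ X Y) {n : ℕ} {v : V} (hv : v ∈ X (n + 1)) :
    ∃ u ∈ splitPart X Y n, ∃ x ∈ X n, u + x = v := by
  have hvm : v ∈ X n ⊔ Y n := by rw [(h.isCompl n).sup_eq_top]; trivial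
  obtain ⟨x, hx, y, hy, rfl⟩ := Submodule.mem_sup.1 hvm
  refine ⟨y, ⟨?_, hy⟩, x, hx, add_comm _ _⟩
  exact (Submodule.add_mem_iff_right _ (h.X_mono n.le_succ hx)).1 hv

theorem splitPart_of_lt (h : IsSplitFlagPair d A C θ φ X Y) {n : ℕ} (hn : d < n) :
    splitPart X Y n = ⊥ :=
  le_bot_iff.1 ((inf_le_right.trans (h.Y_anti hn)).trans h.Y_bot.le)

/-- The components span, so a linear map is determined by its restrictions to them. -/
theorem hom_ext (h : IsSplitFlagPair d A C θ φ X Y) {f g : End 𝕂 V}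
    (hfg : ∀ n, ∀ v ∈ splitPart X Y n, f v = g v) : f = g := by
  have : (⊤ : Submodule 𝕂 V) ≤ LinearMap.eqLocus f g := by
    rw [← h.iSup_splitPart]
    exact iSup_le fun n v hv => hfg n v hv
  exact LinearMap.ext fun v => this trivial

/-- Any prescription of scalars on the components of the split decomposition is realized by a
linear map: combine the differences of successive projections onto `X n` along `Y n`. -/
theorem exists_weight (h : IsSplitFlagPair d A C θ φ X Y) (c : ℕ → 𝕂) :
    ∃ f : End 𝕂 V, ∀ n, ∀ v ∈ splitPart X Y n, f v = c n • v := by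
  classical
  let π : ℕ → End 𝕂 V := fun n => (X n).projection (Y n) (h.isCompl n)
  have hπ : ∀ n m, ∀ v ∈ splitPart X Y n, π m v = if n < m then v else 0 := fun n m v hv => by
    split_ifs with hnm
    · exact Submodule.projection_apply_of_mem_left _ (h.X_mono hnm hv.1)
    · exact Submodule.projection_apply_of_mem_right _ (h.Y_anti (not_lt.1 hnm) hv.2)
  refine ⟨∑ m ∈ Finset.range (d + 1), c m • (π (m + 1) - π m), fun n v hv => ?_⟩
  rcases lt_or_ge d n with hn | hn
  · have hv0 : v = 0 := by simpa [h.splitPart_of_lt hn] using hv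
    simp [hv0]
  · simp only [LinearMap.sum_apply, LinearMap.smul_apply, LinearMap.sub_apply]
    rw [Finset.sum_eq_single n]
    · simp [hπ n _ v hv]
    · intro m _ hm
      have : n < m + 1 ↔ n < m := by omega
      simp [hπ n _ v hv, this]
    · intro hn'
      simp at hn'
      omega

theorem apply_sub_smul_mem_splitPart (h : IsSplitFlagPair d A C θ φ X Y) {n : ℕ} {v : V}
    (hv : v ∈ splitPart X Y n) : A v - θ n • v ∈ splitPart X Y (n + 1) :=
  ⟨h.sub_smul_mem_X _ hv.1, h.A_Y n v hv.2⟩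

/-- A map that is scalar on each component of the split decomposition acts on `X (n + 1) / X n`
as the corresponding scalar. -/
theorem weight_sub_smul_mem (h : IsSplitFlagPair d A C θ φ X Y) {f : End 𝕂 V} {c : ℕ → 𝕂}
    (hf : ∀ n, ∀ v ∈ splitPart X Y n, f v = c n • v) (n : ℕ) :
    ∀ v ∈ X (n + 1), f v - c n • v ∈ X n := by
  have hX : ∀ n, ∀ v ∈ X n, f v ∈ X n := fun n => by
    induction n with
    | zero =>
      intro v hv
      have hv0 : v = 0 := by simpa [h.X_zero] using hv
      simp [hv0]
    | succ n ih =>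
      intro v hv
      obtain ⟨u, hu, x, hx, rfl⟩ := h.exists_add hv
      rw [map_add, hf n u hu]
      exact add_mem (Submodule.smul_mem _ _ hu.1) (h.X_mono n.le_succ (ih x hx))
  intro v hv
  obtain ⟨u, hu, x, hx, rfl⟩ := h.exists_add hv
  rw [map_add, hf n u hu, smul_add, add_sub_add_left_eq_sub]
  exact sub_mem (hX n x hx) (Submodule.smul_mem _ _ hx)

theorem weight_mem (h : IsSplitFlagPair d A C θ φ X Y) {f : End 𝕂 V} {c : ℕ → 𝕂}
    (hf : ∀ n, ∀ v ∈ splitPart X Y n, f v = c n • v) (n : ℕ) {v : V} (hv : v ∈ X n) :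
    f v ∈ X n := by
  cases n with
  | zero =>
    have hv0 : v = 0 := by simpa [h.X_zero] using hv
    simp [hv0]
  | succ n =>
    have := add_mem (h.X_mono n.le_succ (h.weight_sub_smul_mem hf n v hv))
      (Submodule.smul_mem _ (c n) hv)
    rwa [sub_add_cancel] at this

end IsSplitFlagPair

/-! ### The two split decompositions of a tridiagonal pair -/

variable {d : ℕ} {A C : End 𝕂 V} {θ φ : ℕ → 𝕂} {W W' : Fin (d + 1) → Submodule 𝕂 V}

theorem lowerFlag_one_ne_bot (h : IsTridiagonalDecomposition C A φ W') : lowerFlag W' 1 ≠ ⊥ :=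
  fun h0 => h.ne_bot 0 (le_bot_iff.1 ((le_lowerFlag (by simp)).trans h0.le))

theorem lowerFlag_ne_top (h : IsTridiagonalDecomposition C A φ W') : lowerFlag W' d ≠ ⊤ :=
  fun h0 => h.ne_bot (Fin.last d) <| by
    have h1 := (h.isCompl d).disjoint
    rw [h0, disjoint_comm, disjoint_top] at h1
    exact le_bot_iff.1 ((le_upperFlag (by simp)).trans h1.le)

theorem isSplitFlagPair_upperFlag (h : IsTridiagonalDecomposition A C θ W)
    (h' : IsTridiagonalDecomposition C A φ W')
    (hirr : ¬ ∃ S : Submodule 𝕂 V, S.map A ≤ S ∧ S.map C ≤ S ∧ S ≠ ⊥ ∧ S ≠ ⊤) :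
    IsSplitFlagPair d A C θ φ (lowerFlag W') (upperFlag W) where
  X_mono := lowerFlag_mono
  X_zero := lowerFlag_zero
  X_top := by rw [lowerFlag_of_lt d.lt_succ_self, h'.iSup_eq_top]
  X_ne_bot := lowerFlag_one_ne_bot h'
  X_ne_top := lowerFlag_ne_top h'
  Y_anti := upperFlag_anti
  Y_zero := by rw [upperFlag_zero, h.iSup_eq_top]
  Y_bot := upperFlag_of_lt d.lt_succ_self
  A_X _ _ hv := h'.map_lowerFlag hv
  A_Y _ _ hv := h.apply_sub_smul_mem_upperFlag hv
  C_X _ _ hv := h'.apply_sub_smul_mem_lowerFlag hv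
  C_Y _ _ hv := h.map_upperFlag hv
  irreducible := hirr

/-- Reversing the order of the eigenspaces of `A` gives a second split decomposition. -/
theorem isSplitFlagPair_lowerFlag (h : IsTridiagonalDecomposition A C θ W)
    (h' : IsTridiagonalDecomposition C A φ W')
    (hirr : ¬ ∃ S : Submodule 𝕂 V, S.map A ≤ S ∧ S.map C ≤ S ∧ S ≠ ⊥ ∧ S ≠ ⊤) :
    IsSplitFlagPair d A C (fun n => θ (d - n)) φ (lowerFlag W')
      (fun n => lowerFlag W (d + 1 - n)) where
  X_mono := lowerFlag_mono
  X_zero := lowerFlag_zero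
  X_top := by rw [lowerFlag_of_lt d.lt_succ_self, h'.iSup_eq_top]
  X_ne_bot := lowerFlag_one_ne_bot h'
  X_ne_top := lowerFlag_ne_top h'
  Y_anti _ _ hmn := lowerFlag_mono (Nat.sub_le_sub_left hmn _)
  Y_zero := by rw [Nat.sub_zero, lowerFlag_of_lt d.lt_succ_self, h.iSup_eq_top]
  Y_bot := by rw [Nat.sub_self, lowerFlag_zero]
  A_X _ _ hv := h'.map_lowerFlag hv
  A_Y n v hv := by
    rcases lt_or_ge d n with hn | hn
    · rw [show d + 1 - n = 0 by omega, lowerFlag_zero, Submodule.mem_bot] at hv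
      simp [hv]
    · rw [show d + 1 - (n + 1) = d - n by omega]
      rw [show d + 1 - n = d - n + 1 by omega] at hv
      exact h.apply_sub_smul_mem_lowerFlag hv
  C_X _ _ hv := h'.apply_sub_smul_mem_lowerFlag hv
  C_Y n v hv := by
    rcases lt_or_ge d n with hn | hn
    · rw [show d + 1 - (n + 1) = 0 by omega, lowerFlag_zero, Submodule.mem_bot] at hv
      simp [hv]
    · exact lowerFlag_mono (by omega) (h.map_lowerFlag hv)
  irreducible := hirr

end SplitDecompositions

section Raising

variable {𝕂 V : Type*} [Field 𝕂] [AddCommGroup V] [Module 𝕂 V]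

/-! ### The raising map of a split decomposition -/

namespace IsSplitFlagPair

variable {d : ℕ} {A C R : End 𝕂 V} {θ φ : ℕ → 𝕂} {X Y : ℕ → Submodule 𝕂 V}

/-- The hypothesis `hR`, here and below, says that `R` is the raising part of `A`: the difference
of `A` and the map acting as `θ n` on the `n`-th component. -/
theorem raising_mem_splitPart (h : IsSplitFlagPair d A C θ φ X Y)
    (hR : ∀ n, ∀ v ∈ splitPart X Y n, R v = A v - θ n • v) {n : ℕ} {v : V}
    (hv : v ∈ splitPart X Y n) : R v ∈ splitPart X Y (n + 1) := by
  rw [hR n v hv]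
  exact h.apply_sub_smul_mem_splitPart hv

theorem raising_pow_mem_splitPart (h : IsSplitFlagPair d A C θ φ X Y)
    (hR : ∀ n, ∀ v ∈ splitPart X Y n, R v = A v - θ n • v) (m : ℕ) {n : ℕ} {v : V}
    (hv : v ∈ splitPart X Y n) : (R ^ m) v ∈ splitPart X Y (n + m) := by
  induction m with
  | zero => simpa using hv
  | succ m ih =>
    rw [pow_succ', Module.End.mul_apply]
    exact h.raising_mem_splitPart hR ih

theorem raising_mem (h : IsSplitFlagPair d A C θ φ X Y)
    (hR : ∀ n, ∀ v ∈ splitPart X Y n, R v = A v - θ n • v) {n : ℕ} {v : V}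
    (hv : v ∈ X n) : R v ∈ X (n + 1) := by
  induction n generalizing v with
  | zero =>
    have hv0 : v = 0 := by simpa [h.X_zero] using hv
    simp [hv0]
  | succ n ih =>
    obtain ⟨u, hu, x, hx, rfl⟩ := h.exists_add hv
    rw [map_add]
    exact add_mem (h.raising_mem_splitPart hR hu).1 (h.X_mono (by omega) (ih hx))

theorem raising_pow_mem (h : IsSplitFlagPair d A C θ φ X Y)
    (hR : ∀ n, ∀ v ∈ splitPart X Y n, R v = A v - θ n • v) (m : ℕ) {n : ℕ} {v : V}
    (hv : v ∈ X n) : (R ^ m) v ∈ X (n + m) := by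
  induction m with
  | zero => simpa using hv
  | succ m ih =>
    rw [pow_succ', Module.End.mul_apply]
    exact h.raising_mem hR ih

section Eigenspaces

variable {W : Fin (d + 1) → Submodule 𝕂 V} {ψ : ℕ → 𝕂}

/-- If `R ^ m` kills a vector of the `j`-th component, then so does
`(A - θ j) ⋯ (A - θ (j + m - 1))`, and the vector lies in the sum of the first `j + m`
eigenspaces. -/
theorem mem_lowerFlag_of_raising_pow_eq_zero
    (h : IsSplitFlagPair d A C θ φ X (upperFlag W)) (hW : IsTridiagonalDecomposition A C θ W)
    (hR : ∀ n, ∀ v ∈ splitPart X (upperFlag W) n, R v = A v - θ n • v) (m : ℕ) {j : ℕ} {v : V}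
    (hv : v ∈ splitPart X (upperFlag W) j) (h0 : (R ^ m) v = 0) : v ∈ lowerFlag W (j + m) := by
  induction m generalizing j v with
  | zero =>
    have hv0 : v = 0 := by simpa using h0
    simp [hv0]
  | succ m ih =>
    refine hW.mem_lowerFlag_of_apply_sub_smul_mem (j := j) (by omega) ?_
    rw [← hR j v hv, show j + (m + 1) = j + 1 + m by omega]
    exact ih (h.raising_mem_splitPart hR hv) (by rwa [pow_succ, Module.End.mul_apply] at h0)

variable (h : IsSplitFlagPair d A C θ φ X (upperFlag W))
  (h₂ : IsSplitFlagPair d A C ψ φ X (fun n => lowerFlag W (d + 1 - n)))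
  (hW : IsTridiagonalDecomposition A C θ W)
  (hR : ∀ n, ∀ v ∈ splitPart X (upperFlag W) n, R v = A v - θ n • v)

include h h₂ hW hR

/-- The first split decomposition gives the eigenspace location of a vector killed by `R ^ m`, and
the second one shows that it vanishes. -/
theorem eq_zero_of_raising_pow_eq_zero {m j : ℕ} (hmj : m + 2 * j ≤ d) {v : V}
    (hv : v ∈ splitPart X (upperFlag W) j) (h0 : (R ^ m) v = 0) : v = 0 := by
  refine Submodule.disjoint_def.1 (h₂.disjoint (j + 1)) v hv.1 ?_
  exact lowerFlag_mono (by omega) (h.mem_lowerFlag_of_raising_pow_eq_zero hW hR m hv h0)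

/-- Injectivity of `R ^ m` on the quotient `X (j + 1) / X j`. -/
theorem mem_of_raising_pow_mem {m j : ℕ} (hmj : m + 2 * j ≤ d) {v : V}
    (hv : v ∈ X (j + 1)) (hm : (R ^ m) v ∈ X (j + m)) : v ∈ X j := by
  obtain ⟨u, hu, x, hx, rfl⟩ := h.exists_add hv
  have hu0 : u = 0 := by
    refine h.eq_zero_of_raising_pow_eq_zero h₂ hW hR hmj hu ?_
    refine Submodule.disjoint_def.1 (h.disjoint (j + m)) _ ?_
      (h.raising_pow_mem_splitPart hR m hu).2
    rw [map_add] at hm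
    exact (Submodule.add_mem_iff_left _ (h.raising_pow_mem hR m hx)).1 hm
  rwa [hu0, zero_add]

omit hR in
/-- Each `X n` is complementary both to the upper flag at `n` and to the lower flag at `d + 1 - n` of
`A`, while those two flags are complementary at the same index; comparing dimensions gives the
symmetry. -/
theorem finrank_splitPart_symm [FiniteDimensional 𝕂 V] {j : ℕ} (hj : j ≤ d) :
    finrank 𝕂 (splitPart X (upperFlag W) j) = finrank 𝕂 (splitPart X (upperFlag W) (d - j)) := by
  have hX : ∀ n ≤ d + 1, finrank 𝕂 (X n) + finrank 𝕂 (X (d + 1 - n)) = finrank 𝕂 V := by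
    intro n hn
    have h1 := Submodule.finrank_add_eq_of_isCompl (h.isCompl n)
    have h2 := Submodule.finrank_add_eq_of_isCompl (h₂.isCompl (d + 1 - n))
    have h3 := Submodule.finrank_add_eq_of_isCompl (hW.isCompl n)
    beta_reduce at h2
    rw [show d + 1 - (d + 1 - n) = n by omega] at h2
    omega
  have hU : ∀ n, finrank 𝕂 (splitPart X (upperFlag W) n) + finrank 𝕂 (X n)
      = finrank 𝕂 (X (n + 1)) := by
    intro n
    have hsup : splitPart X (upperFlag W) n ⊔ X n = X (n + 1) := by
      refine le_antisymm (sup_le inf_le_left (h.X_mono n.le_succ)) fun v hv => ?_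
      obtain ⟨u, hu, x, hx, rfl⟩ := h.exists_add hv
      exact Submodule.add_mem_sup hu hx
    have hinf : splitPart X (upperFlag W) n ⊓ X n = ⊥ :=
      ((h.disjoint n).symm.mono_left inf_le_right).eq_bot
    have := Submodule.finrank_sup_add_finrank_inf_eq (splitPart X (upperFlag W) n) (X n)
    rw [hsup, hinf, finrank_bot] at this
    omega
  have h1 := hX j (by omega)
  have h2 := hX (j + 1) (by omega)
  have h3 := hU j
  have h4 := hU (d - j)
  rw [show d + 1 - (j + 1) = d - j by omega] at h2
  rw [show d + 1 - j = d - j + 1 by omega] at h1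
  omega

theorem exists_raising_pow_eq [FiniteDimensional 𝕂 V] {j : ℕ} (hj : 2 * j ≤ d) {v : V}
    (hv : v ∈ splitPart X (upperFlag W) (d - j)) :
    ∃ u ∈ splitPart X (upperFlag W) j, (R ^ (d - 2 * j)) u = v := by
  have hmap : (splitPart X (upperFlag W) j).map (R ^ (d - 2 * j))
      ≤ splitPart X (upperFlag W) (d - j) := by
    rintro _ ⟨u, hu, rfl⟩
    have := h.raising_pow_mem_splitPart hR (d - 2 * j) hu
    rwa [show j + (d - 2 * j) = d - j by omega] at this
  have hinj : Function.Injective ((R ^ (d - 2 * j)).domRestrict (splitPart X (upperFlag W) j)) := by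
    rw [injective_iff_map_eq_zero]
    rintro ⟨u, hu⟩ h0
    exact Subtype.ext (h.eq_zero_of_raising_pow_eq_zero h₂ hW hR (by omega) hu h0)
  have hrange : (splitPart X (upperFlag W) j).map (R ^ (d - 2 * j))
      = splitPart X (upperFlag W) (d - j) := by
    refine Submodule.eq_of_le_of_finrank_eq hmap ?_
    rw [← h.finrank_splitPart_symm h₂ hW (by omega), ← LinearMap.range_domRestrict]
    exact LinearMap.finrank_range_of_inj hinj
  rw [← hrange] at hv
  exact hv

/-- The analogue of the `sl₂` decomposition into images of lowest weight vectors: modulo the image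
of `R`, every vector of the `n`-th component can be chosen of lowest weight. In natural number
subtraction the exponent `d + 1 - 2 * n` is `0` above the middle, where `R` is surjective. -/
theorem exists_raising_pow_sub_eq_zero [FiniteDimensional 𝕂 V] {n : ℕ} {v : V}
    (hv : v ∈ splitPart X (upperFlag W) (n + 1)) :
    ∃ u ∈ splitPart X (upperFlag W) n, (R ^ (d + 1 - 2 * (n + 1))) (v - R u) = 0 := by
  rcases lt_or_ge d (n + 1) with hn | hn
  · have hv0 : v = 0 := by simpa [h.splitPart_of_lt hn] using hv
    exact ⟨0, zero_mem _, by simp [hv0]⟩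
  rcases lt_or_ge d (2 * (n + 1)) with h2 | h2
  · rw [show n + 1 = d - (d - (n + 1)) by omega] at hv
    obtain ⟨u, hu, rfl⟩ := h.exists_raising_pow_eq h₂ hW hR (by omega) hv
    have hm := h.raising_pow_mem_splitPart hR (n - (d - (n + 1))) hu
    rw [show d - (n + 1) + (n - (d - (n + 1))) = n by omega] at hm
    refine ⟨_, hm, ?_⟩
    rw [← Module.End.mul_apply R, ← pow_succ',
      show d - 2 * (d - (n + 1)) = n - (d - (n + 1)) + 1 by omega, sub_self, map_zero]
  · have hm := h.raising_pow_mem_splitPart hR (d + 1 - 2 * (n + 1)) hv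
    rw [show n + 1 + (d + 1 - 2 * (n + 1)) = d - n by omega] at hm
    obtain ⟨u, hu, hum⟩ := h.exists_raising_pow_eq h₂ hW hR (by omega) hm
    refine ⟨u, hu, ?_⟩
    rw [map_sub, ← hum, ← Module.End.mul_apply _ R, ← pow_succ,
      show d - 2 * n = d + 1 - 2 * (n + 1) + 1 by omega, sub_self]

omit h₂ hW in
/-- Commutation of `M` with `R` up to the scalar `c`, modulo lower terms of the flag, passes to powers
of `R`. -/
theorem raising_pow_comm_mem {M : End 𝕂 V} {c : 𝕂} {r : ℕ}
    (hM : ∀ n, ∀ v ∈ X n, R (M v) - c • M (R v) ∈ X (n - r)) {n : ℕ} (hrn : r ≤ n) (m : ℕ) {v : V}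
    (hv : v ∈ X (n + 1)) : (R ^ m) (M v) - c ^ m • M ((R ^ m) v) ∈ X (n - r + m) := by
  induction m with
  | zero => simp
  | succ m ih =>
    have h1 := h.raising_mem hR ih
    have h2 := Submodule.smul_mem _ (c ^ m) (hM _ _ (h.raising_pow_mem hR m hv))
    rw [show n + 1 + m - r = n - r + m + 1 by omega] at h2
    have h3 := add_mem h1 h2
    simp only [map_sub, map_smul, smul_sub, smul_smul, ← pow_succ, sub_add_sub_cancel] at h3
    rw [← add_assoc]
    simpa only [pow_succ' R, Module.End.mul_apply] using h3

/-- A map that lowers the flag `X` by `r ≥ 1` steps and commutes with `R` up to a nonzero scalar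
on the associated graded space lowers `X` by `r + 1` steps: it sends lowest weight vectors to
vectors killed by a power of `R` that is injective in their degree. -/
theorem lowering_succ [FiniteDimensional 𝕂 V] {M : End 𝕂 V} {c : 𝕂} (hc : c ≠ 0) {r : ℕ}
    (hr : 1 ≤ r) (hMr : ∀ n, ∀ v ∈ X n, M v ∈ X (n - r))
    (hM : ∀ n, ∀ v ∈ X n, R (M v) - c • M (R v) ∈ X (n - r)) (n : ℕ) :
    ∀ v ∈ X n, M v ∈ X (n - (r + 1)) := by
  have hbot : ∀ {n : ℕ}, n ≤ r → ∀ v ∈ X n, M v = 0 := fun {n} hn v hv => by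
    have := hMr n v hv
    rwa [Nat.sub_eq_zero_of_le hn, h.X_zero, Submodule.mem_bot] at this
  induction n with
  | zero =>
    intro v hv
    rw [hbot (Nat.zero_le r) v hv]
    exact zero_mem _
  | succ n ih =>
    intro v hv
    rcases le_or_gt (n + 1) r with hnr | hnr
    · rw [hbot hnr v hv]
      exact zero_mem _
    rw [show n + 1 - (r + 1) = n - r by omega]
    obtain ⟨v', hv', x, hx, rfl⟩ := h.exists_add hv
    rw [map_add]
    refine add_mem ?_ (h.X_mono (by omega) (ih x hx))
    obtain ⟨n, rfl⟩ : ∃ k, n = k + 1 := ⟨n - 1, by omega⟩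
    obtain ⟨u, hu, hκ⟩ := h.exists_raising_pow_sub_eq_zero h₂ hW hR hv'
    rw [← sub_add_cancel v' (R u), map_add]
    refine add_mem ?_ ?_
    · have hκm : v' - R u ∈ X (n + 1 + 1) :=
        (sub_mem hv' (h.raising_mem_splitPart hR hu)).1
      rcases lt_or_ge (d + 1) (2 * (n + 1)) with h2 | h2
      · rw [show d + 1 - 2 * (n + 1) = 0 by omega, pow_zero, Module.End.one_apply] at hκ
        simp [hκ]
      -- Here `r ≥ 1` is used: `M` sends the degree `n + 1` to the degree `n + 1 - r`, where
      -- `R ^ (d + 1 - 2 * (n + 1))` is injective.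
      · refine h.mem_of_raising_pow_mem h₂ hW hR (m := d + 1 - 2 * (n + 1)) (by omega) ?_ ?_
        · have := hMr _ _ hκm
          rwa [show n + 1 + 1 - r = n + 1 - r + 1 by omega] at this
        · have := h.raising_pow_comm_mem hR hM (n := n + 1) (by omega) (d + 1 - 2 * (n + 1)) hκm
          rwa [hκ, map_zero, smul_zero, sub_zero] at this
    · have h1 : R (M u) ∈ X (n + 1 - r) := by
        rcases le_or_gt (n + 1) r with hnr' | hnr'
        · rw [hbot hnr' u hu.1, map_zero]
          exact zero_mem _
        · have := h.raising_mem hR (ih u hu.1)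
          rwa [show n + 1 - (r + 1) + 1 = n + 1 - r by omega] at this
      have h2 := sub_mem h1 (hM _ u hu.1)
      rw [sub_sub_cancel] at h2
      exact (Submodule.smul_mem_iff _ hc).1 h2

/-- Iterating `lowering_succ` until the flag is exhausted. -/
theorem eq_zero_of_lowering [FiniteDimensional 𝕂 V] {M : End 𝕂 V} {c : 𝕂} (hc : c ≠ 0)
    (hM1 : ∀ n, ∀ v ∈ X n, M v ∈ X (n - 1))
    (hM : ∀ r, (∀ n, ∀ v ∈ X n, M v ∈ X (n - r)) →
      ∀ n, ∀ v ∈ X n, R (M v) - c • M (R v) ∈ X (n - r)) : M = 0 := by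
  have key : ∀ r, ∀ n, ∀ v ∈ X n, M v ∈ X (n - (r + 1)) := fun r => by
    induction r with
    | zero => exact hM1
    | succ r ih => exact h.lowering_succ h₂ hW hR hc (by omega) ih (hM _ ih)
  refine LinearMap.ext fun v => ?_
  have := key d (d + 1) v (by rw [h.X_top]; trivial)
  rwa [Nat.sub_self, h.X_zero, Submodule.mem_bot] at this

end Eigenspaces

/-! ### The weight maps -/

/-- On the split decomposition, `A` is the sum of its diagonal part and a raising part, which
`k` commutes with up to a factor `q ^ 2`. -/
theorem weyl_relation (h : IsSplitFlagPair d A C θ φ X Y) {q a : 𝕂} (hq : q ≠ 0) (ha : a ≠ 0)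
    (hθ : ∀ n ≤ d, θ n = a * q ^ ((d : ℤ) - 2 * n) + a⁻¹ * q ^ (2 * (n : ℤ) - d))
    {k : End 𝕂 V} (hk : ∀ n, ∀ v ∈ splitPart X Y n, k v = q ^ (2 * (n : ℤ) - d) • v) :
    q • (A * k) - q⁻¹ • (k * A) = (q - q⁻¹) • (a • (1 : End 𝕂 V) + a⁻¹ • (k * k)) := by
  refine h.hom_ext fun n v hv => ?_
  rcases lt_or_ge d n with hn | hn
  · have hv0 : v = 0 := by simpa [h.splitPart_of_lt hn] using hv
    simp [hv0]
  have h1 := hk _ _ (h.apply_sub_smul_mem_splitPart hv)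
  rw [map_sub, map_smul, hk n v hv, sub_eq_iff_eq_add] at h1
  simp only [LinearMap.sub_apply, LinearMap.add_apply, LinearMap.smul_apply, Module.End.mul_apply,
    Module.End.one_apply, hk n v hv, h1, map_smul, hθ n hn]
  have e1 : q ^ (2 * ((n + 1 : ℕ) : ℤ) - d) = q ^ 2 * q ^ (2 * (n : ℤ) - d) := by
    rw [← zpow_natCast, ← zpow_add₀ hq]
    congr 1
    push_cast
    ring
  have e2 : q ^ ((d : ℤ) - 2 * n) = (q ^ (2 * (n : ℤ) - d))⁻¹ := by
    rw [← zpow_neg, neg_sub]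
  have e3 : q ^ (2 * (n : ℤ) - d) ≠ 0 := zpow_ne_zero _ hq
  rw [e1, e2]
  generalize q ^ (2 * (n : ℤ) - d) = p at *
  match_scalars <;> field_simp <;> ring

end IsSplitFlagPair

end Raising

/-! ### The cubic consequence of the two `q`-Weyl type relations -/

/-- The two relations make `A` act on words in `k` and `β` like a twisted derivation. Applied to the
quadratic expression `M` this gives, after cancellation of the linear terms, a cubic which is again
a combination of `β * M`, `k * M`, `M * β` and `M * k`; the condition `a ^ 2 ≠ 1` is what makes the
linear system for the coefficients solvable. -/
theorem exists_intertwining {𝕂 R : Type*} [Field 𝕂] [Ring R] [Algebra 𝕂 R]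
    (q a : 𝕂) (hq : q ≠ 0) (ha : a ≠ 0) (hq2 : q ^ 2 ≠ 1) (ha2 : a ^ 2 ≠ 1) (A k β : R)
    (hk : q • (A * k) - q⁻¹ • (k * A) = (q - q⁻¹) • (a • (1 : R) + a⁻¹ • (k * k)))
    (hβ : q • (A * β) - q⁻¹ • (β * A) = (q - q⁻¹) • (a⁻¹ • (1 : R) + a • (β * β)))
    (M : R) (hM : M = a • β ^ 2
          - ((a⁻¹ * q - a * q⁻¹) / (q - q⁻¹)) • (k * β)
          - ((a * q - a⁻¹ * q⁻¹) / (q - q⁻¹)) • (β * k)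
          + a⁻¹ • k ^ 2) :
    ∃ x y z w : 𝕂, A * M - (q⁻¹ ^ 4) • (M * A)
      = (x • β + z • k) * M + M * (y • β + w • k) := by
  have hs : q ^ 2 - 1 ≠ 0 := sub_ne_zero.2 hq2
  have hr : 1 - a ^ 2 ≠ 0 := sub_ne_zero.2 (Ne.symm ha2)
  have hs' : q - q⁻¹ = (q ^ 2 - 1) / q := by field_simp
  -- Rewriting rules that move `A` to the right past `k` and `β`.
  have hk' : A * k = (q⁻¹ ^ 2) • (k * A)
      + ((q ^ 2 - 1) / q ^ 2) • (a • (1 : R) + a⁻¹ • (k * k)) := by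
    rw [hs'] at hk
    have h := congrArg (fun z => q⁻¹ • z) (sub_eq_iff_eq_add.1 hk)
    simp only [smul_smul, inv_mul_cancel₀ hq, one_smul] at h
    rw [h]
    match_scalars <;> field_simp
  have hβ' : A * β = (q⁻¹ ^ 2) • (β * A)
      + ((q ^ 2 - 1) / q ^ 2) • (a⁻¹ • (1 : R) + a • (β * β)) := by
    rw [hs'] at hβ
    have h := congrArg (fun z => q⁻¹ • z) (sub_eq_iff_eq_add.1 hβ)
    simp only [smul_smul, inv_mul_cancel₀ hq, one_smul] at h
    rw [h]
    match_scalars <;> field_simp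
  have hkx : ∀ z : R, A * (k * z) = (q⁻¹ ^ 2) • (k * (A * z))
      + ((q ^ 2 - 1) / q ^ 2) • (a • z + a⁻¹ • (k * (k * z))) := fun z => by
    rw [← mul_assoc, hk']
    simp only [add_mul, smul_mul_assoc, mul_assoc, one_mul]
  have hβx : ∀ z : R, A * (β * z) = (q⁻¹ ^ 2) • (β * (A * z))
      + ((q ^ 2 - 1) / q ^ 2) • (a⁻¹ • z + a • (β * (β * z))) := fun z => by
    rw [← mul_assoc, hβ']
    simp only [add_mul, smul_mul_assoc, mul_assoc, one_mul]
  refine ⟨-((a ^ 2 * q ^ 2 - 1) * (q ^ 2 - 1) * a / (q ^ 4 * (1 - a ^ 2))),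
    (q ^ 2 - a ^ 2) * (q ^ 2 - 1) * a / (q ^ 4 * (1 - a ^ 2)),
    (q ^ 2 - a ^ 2) * (q ^ 2 - 1) / (a * q ^ 4 * (1 - a ^ 2)),
    -((a ^ 2 * q ^ 2 - 1) * (q ^ 2 - 1) / (a * q ^ 4 * (1 - a ^ 2))), ?_⟩
  subst hM
  rw [hs']
  simp only [pow_two β, pow_two k, mul_add, mul_sub, add_mul, sub_mul, mul_smul_comm,
    smul_mul_assoc, mul_assoc, hk', hβ', hkx, hβx, smul_add, smul_sub, smul_smul, mul_one]
  match_scalars <;> field_simp <;> ring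

section QuadraticRelation

variable {𝕂 V : Type*} [Field 𝕂] [AddCommGroup V] [Module 𝕂 V]

/-! ### The quadratic relation -/

section FlagQuotients

variable {X : ℕ → Submodule 𝕂 V} {f g : End 𝕂 V} {c e : ℕ → 𝕂}

theorem mul_sub_smul_mem (hf : ∀ n, ∀ v ∈ X (n + 1), f v - c n • v ∈ X n)
    (hf' : ∀ n, ∀ v ∈ X n, f v ∈ X n)
    (hg : ∀ n, ∀ v ∈ X (n + 1), g v - e n • v ∈ X n) (n : ℕ) :
    ∀ v ∈ X (n + 1), (f * g) v - (c n * e n) • v ∈ X n := fun v hv => by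
  have h1 := hf' n _ (hg n v hv)
  have h2 := Submodule.smul_mem _ (e n) (hf n v hv)
  have h3 := add_mem h1 h2
  simp only [map_sub, map_smul, smul_sub, smul_smul, sub_add_sub_cancel] at h3
  rwa [Module.End.mul_apply, mul_comm (c n)]

end FlagQuotients

/-- The left hand side of the quadratic relation between the inverse weight maps `k` and `β`. -/
def quadraticForm (q a : 𝕂) (k β : End 𝕂 V) : End 𝕂 V :=
  a • β ^ 2 - ((a⁻¹ * q - a * q⁻¹) / (q - q⁻¹)) • (k * β)
    - ((a * q - a⁻¹ * q⁻¹) / (q - q⁻¹)) • (β * k) + a⁻¹ • k ^ 2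

/-- On `X (n + 1) / X n` both `k` and `β` act as the same scalar `c n`, and the coefficients of the
quadratic form add up to `0`. -/
theorem quadraticForm_apply_mem {X : ℕ → Submodule 𝕂 V} (hX : X 0 = ⊥) {q a : 𝕂}
    (hs : q - q⁻¹ ≠ 0) {k β : End 𝕂 V} {c : ℕ → 𝕂}
    (hk : ∀ n, ∀ v ∈ X (n + 1), k v - c n • v ∈ X n)
    (hk' : ∀ n, ∀ v ∈ X n, k v ∈ X n)
    (hβ : ∀ n, ∀ v ∈ X (n + 1), β v - c n • v ∈ X n)
    (hβ' : ∀ n, ∀ v ∈ X n, β v ∈ X n) (n : ℕ) :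
    ∀ v ∈ X n, quadraticForm q a k β v ∈ X (n - 1) := fun v hv => by
  cases n with
  | zero =>
    have hv0 : v = 0 := by simpa [hX] using hv
    simp [hv0]
  | succ n =>
    rw [Nat.add_sub_cancel]
    have h1 := Submodule.smul_mem _ a (mul_sub_smul_mem hβ hβ' hβ n v hv)
    have h2 := Submodule.smul_mem _ ((a⁻¹ * q - a * q⁻¹) / (q - q⁻¹))
      (mul_sub_smul_mem hk hk' hβ n v hv)
    have h3 := Submodule.smul_mem _ ((a * q - a⁻¹ * q⁻¹) / (q - q⁻¹))
      (mul_sub_smul_mem hβ hβ' hk n v hv)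
    have h4 := Submodule.smul_mem _ a⁻¹ (mul_sub_smul_mem hk hk' hk n v hv)
    have hc : (a⁻¹ * q - a * q⁻¹) / (q - q⁻¹) + (a * q - a⁻¹ * q⁻¹) / (q - q⁻¹) = a + a⁻¹ := by
      rw [← add_div, div_eq_iff hs]
      ring
    have hc2 : (a * q - a⁻¹ * q⁻¹) / (q - q⁻¹) = a + a⁻¹ - (a⁻¹ * q - a * q⁻¹) / (q - q⁻¹) := by
      rw [← hc, add_sub_cancel_left]
    convert add_mem (sub_mem (sub_mem h1 h2) h3) h4 using 1
    simp only [quadraticForm, pow_two, LinearMap.add_apply, LinearMap.sub_apply,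
      LinearMap.smul_apply]
    rw [hc2]
    module

/-- The quadratic form lowers the flag by one step and, by the intertwining identity, commutes with
`R` up to `q⁻¹ ^ 4` modulo maps preserving the flag, so it vanishes. -/
theorem quadraticForm_eq_zero [FiniteDimensional 𝕂 V] {d : ℕ} {A C : End 𝕂 V} {θ φ : ℕ → 𝕂}
    {W W' : Fin (d + 1) → Submodule 𝕂 V} (hW : IsTridiagonalDecomposition A C θ W)
    (hW' : IsTridiagonalDecomposition C A φ W')
    (hirr : ¬ ∃ S : Submodule 𝕂 V, S.map A ≤ S ∧ S.map C ≤ S ∧ S ≠ ⊥ ∧ S ≠ ⊤)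
    {q a : 𝕂} (hq : q ≠ 0) (ha : a ≠ 0) (hq2 : q ^ 2 ≠ 1) (ha2 : a ^ 2 ≠ 1)
    (hθ : ∀ n, θ n = a * q ^ ((d : ℤ) - 2 * n) + a⁻¹ * q ^ (2 * (n : ℤ) - d))
    {k β : End 𝕂 V}
    (hk : ∀ n, ∀ v ∈ splitPart (lowerFlag W') (upperFlag W) n, k v = q ^ (2 * (n : ℤ) - d) • v)
    (hβ : ∀ n, ∀ v ∈ splitPart (lowerFlag W') (fun n => lowerFlag W (d + 1 - n)) n,
      β v = q ^ (2 * (n : ℤ) - d) • v) :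
    quadraticForm q a k β = 0 := by
  have h := isSplitFlagPair_upperFlag hW hW' hirr
  have h₂ := isSplitFlagPair_lowerFlag hW hW' hirr
  have hs : q - q⁻¹ ≠ 0 := fun h0 => hq2 <| by
    calc q ^ 2 = q * q⁻¹ := by rw [← sub_eq_zero.1 h0, pow_two]
      _ = 1 := mul_inv_cancel₀ hq
  have hψ : ∀ n ≤ d, θ (d - n)
      = a⁻¹ * q ^ ((d : ℤ) - 2 * n) + a⁻¹⁻¹ * q ^ (2 * (n : ℤ) - d) := fun n hn => by
    rw [hθ, Nat.cast_sub hn, inv_inv, add_comm]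
    congr 3 <;> ring
  have hβA := h₂.weyl_relation hq (inv_ne_zero ha) hψ hβ
  rw [inv_inv] at hβA
  obtain ⟨x, y, z, w, hM⟩ := exists_intertwining q a hq ha hq2 ha2 A k β
    (h.weyl_relation hq ha (fun n _ => hθ n) hk) hβA (quadraticForm q a k β) rfl
  obtain ⟨T, hT⟩ := h.exists_weight θ
  have hkX := fun n v (hv : v ∈ lowerFlag W' n) => h.weight_mem hk n hv
  have hβX := fun n v (hv : v ∈ lowerFlag W' n) => h₂.weight_mem hβ n hv
  have hTX := fun n v (hv : v ∈ lowerFlag W' n) => h.weight_mem hT n hv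
  refine h.eq_zero_of_lowering (R := A - T) h₂ hW (fun n v hv => by simp [hT n v hv])
    (pow_ne_zero 4 (inv_ne_zero hq))
    (quadraticForm_apply_mem lowerFlag_zero hs (h.weight_sub_smul_mem hk) hkX
      (h₂.weight_sub_smul_mem hβ) hβX) fun r hr n v hv => ?_
  generalize quadraticForm q a k β = M at *
  have hMv := LinearMap.congr_fun hM v
  simp only [LinearMap.sub_apply, LinearMap.add_apply, LinearMap.smul_apply,
    Module.End.mul_apply] at hMv
  have e : (A - T) (M v) - (q⁻¹ ^ 4) • M ((A - T) v)
      = (x • β (M v) + z • k (M v)) + M (y • β v + w • k v) - T (M v) + (q⁻¹ ^ 4) • M (T v) := by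
    rw [← hMv]
    simp only [LinearMap.sub_apply, map_sub]
    module
  rw [e]
  have hv' := hr n v hv
  exact add_mem (sub_mem (add_mem
    (add_mem (Submodule.smul_mem _ _ (hβX _ _ hv')) (Submodule.smul_mem _ _ (hkX _ _ hv')))
    (hr n _ (add_mem (Submodule.smul_mem _ _ (hβX _ _ hv)) (Submodule.smul_mem _ _ (hkX _ _ hv)))))
    (hTX _ _ hv')) (Submodule.smul_mem _ _ (hr n _ (hTX _ _ hv)))

/-! ### Weight maps of tridiagonal systems -/

variable {d : ℕ} {A C : End 𝕂 V} {θ φ : ℕ → 𝕂} {X Y : ℕ → Submodule 𝕂 V}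

namespace IsSplitFlagPair

theorem actsByWeights_iff (h : IsSplitFlagPair d A C θ φ X Y) {q : 𝕂}
    {U : Fin (d + 1) → Submodule 𝕂 V} (hU : ∀ i, U i = splitPart X Y i) {f : End 𝕂 V} :
    ActsByWeights q U f ↔ ∀ n, ∀ v ∈ splitPart X Y n, f v = q ^ ((d : ℤ) - 2 * n) • v := by
  constructor
  · intro hf n v hv
    rcases lt_or_ge d n with hn | hn
    · have hv0 : v = 0 := by simpa [h.splitPart_of_lt hn] using hv
      simp [hv0]
    · have := hf ⟨n, by omega⟩ v (by rwa [hU])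
      exact sub_eq_zero.1 this
  · intro hf i v hv
    rw [hU] at hv
    exact sub_eq_zero.2 (hf i v hv)

theorem existsUnique_actsByWeights (h : IsSplitFlagPair d A C θ φ X Y) {q : 𝕂}
    {U : Fin (d + 1) → Submodule 𝕂 V} (hU : ∀ i, U i = splitPart X Y i) :
    ∃! f : End 𝕂 V, ActsByWeights q U f := by
  simp only [h.actsByWeights_iff hU]
  obtain ⟨f, hf⟩ := h.exists_weight fun n => q ^ ((d : ℤ) - 2 * n)
  exact ⟨f, hf, fun g hg => h.hom_ext fun n v hv => by rw [hf n v hv, hg n v hv]⟩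

theorem exists_inverse_weight (h : IsSplitFlagPair d A C θ φ X Y) {q : 𝕂} (hq : q ≠ 0)
    {f : End 𝕂 V} (hf : ∀ n, ∀ v ∈ splitPart X Y n, f v = q ^ ((d : ℤ) - 2 * n) • v) :
    ∃ g : End 𝕂 V, (f * g = 1 ∧ g * f = 1) ∧
      ∀ n, ∀ v ∈ splitPart X Y n, g v = q ^ (2 * (n : ℤ) - d) • v := by
  obtain ⟨g, hg⟩ := h.exists_weight fun n => q ^ (2 * (n : ℤ) - d)
  refine ⟨g, ⟨h.hom_ext fun n v hv => ?_, h.hom_ext fun n v hv => ?_⟩, hg⟩ <;>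
  · simp only [Module.End.mul_apply, hf n v hv, hg n v hv, map_smul, smul_smul,
      Module.End.one_apply, ← zpow_add₀ hq]
    simp

end IsSplitFlagPair

theorem firstSplit_eq_splitPart (E E' : Fin (d + 1) → End 𝕂 V) (i : Fin (d + 1)) :
    firstSplit E E' i = splitPart (lowerFlag fun j => LinearMap.range (E' j))
      (upperFlag fun j => LinearMap.range (E j)) i := by
  simp only [firstSplit, splitPart, lowerFlag, upperFlag, Fin.le_def, Nat.lt_succ_iff]

theorem secondSplit_eq_splitPart (E E' : Fin (d + 1) → End 𝕂 V) (i : Fin (d + 1)) :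
    secondSplit E E' i = splitPart (lowerFlag fun j => LinearMap.range (E' j))
      (fun n => lowerFlag (fun j => LinearMap.range (E j)) (d + 1 - n)) i := by
  have : ∀ j : Fin (d + 1), (j : ℕ) + i ≤ d ↔ (j : ℕ) < d + 1 - i := fun j => by omega
  simp only [secondSplit, splitPart, lowerFlag, Fin.le_def, Nat.lt_succ_iff, this]

end QuadraticRelation

theorem theorem9p10 {𝕂 : Type*} [Field 𝕂] [IsAlgClosed 𝕂]
    {V : Type*} [AddCommGroup V] [Module 𝕂 V] [FiniteDimensional 𝕂 V] [Nontrivial V]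
    (d : ℕ) (hd : 1 ≤ d)
    (A : Module.End 𝕂 V) (E : Fin (d + 1) → Module.End 𝕂 V)
    (A' : Module.End 𝕂 V) (E' : Fin (d + 1) → Module.End 𝕂 V)
    (hΦ : IsTDSystem A E A' E')
    (q a b : 𝕂) (hq : IsQRacahType A E A' E' q a b) :
    (∃! K : Module.End 𝕂 V, ActsByWeights q (firstSplit E E') K) ∧
    (∃! B : Module.End 𝕂 V, ActsByWeights q (secondSplit E E') B) ∧
    ∀ K B : Module.End 𝕂 V,
      ActsByWeights q (firstSplit E E') K → ActsByWeights q (secondSplit E E') B →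
      ∃ Kinv Binv : Module.End 𝕂 V,
        (K * Kinv = 1 ∧ Kinv * K = 1) ∧ (B * Binv = 1 ∧ Binv * B = 1) ∧
        a • Binv ^ 2
          - ((a⁻¹ * q - a * q⁻¹) / (q - q⁻¹)) • (Kinv * Binv)
          - ((a * q - a⁻¹ * q⁻¹) / (q - q⁻¹)) • (Binv * Kinv)
          + a⁻¹ • Kinv ^ 2 = 0 := by
  let θ : ℕ → 𝕂 := fun n => a * q ^ ((d : ℤ) - 2 * n) + a⁻¹ * q ^ (2 * (n : ℤ) - d)
  let φ : ℕ → 𝕂 := fun n => b * q ^ ((d : ℤ) - 2 * n) + b⁻¹ * q ^ (2 * (n : ℤ) - d)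
  have hW : IsTridiagonalDecomposition A A' θ fun i => LinearMap.range (E i) :=
    hΦ.standard.isTridiagonalDecomposition hΦ.pair.diagonalizable hq.eigenvalues
  have hW' : IsTridiagonalDecomposition A' A φ fun i => LinearMap.range (E' i) :=
    hΦ.standard'.isTridiagonalDecomposition hΦ.pair.diagonalizable' hq.eigenvalues'
  have h := isSplitFlagPair_upperFlag hW hW' hΦ.pair.irreducible
  have h₂ := isSplitFlagPair_lowerFlag hW hW' hΦ.pair.irreducible
  have hU := firstSplit_eq_splitPart E E'
  have hU₂ := secondSplit_eq_splitPart E E'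
  have hq2 : q ^ 2 ≠ 1 := fun h0 => hq.q_pow_four_ne_one (by
    rw [show q ^ 4 = (q ^ 2) ^ 2 by ring, h0, one_pow])
  -- If `a = a⁻¹` then `θ 0 = θ d`, although `0 ≠ d`.
  have ha2 : a ^ 2 ≠ 1 := fun h0 => by
    have hinv : a⁻¹ = a := inv_eq_of_mul_eq_one_right (by rw [← pow_two, h0])
    have hθ : θ 0 = θ d := by
      simp only [θ, hinv]
      rw [add_comm]
      congr 3 <;> push_cast <;> ring
    have h1 : LinearMap.range (E 0) = LinearMap.range (E (Fin.last d)) := by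
      rw [hW.eq_eigenspace 0, hW.eq_eigenspace (Fin.last d), Fin.val_zero, Fin.val_last, hθ]
    have h2 := congrArg Fin.val (hΦ.idempotents.ordering.1 h1)
    rw [Fin.val_zero, Fin.val_last] at h2
    omega
  refine ⟨h.existsUnique_actsByWeights hU, h₂.existsUnique_actsByWeights hU₂, fun K B hK hB => ?_⟩
  obtain ⟨k, hKk, hk⟩ := h.exists_inverse_weight hq.q_ne_zero ((h.actsByWeights_iff hU).1 hK)
  obtain ⟨β, hBβ, hβ⟩ := h₂.exists_inverse_weight hq.q_ne_zero ((h₂.actsByWeights_iff hU₂).1 hB)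
  exact ⟨k, β, hKk, hBβ, quadraticForm_eq_zero hW hW' hΦ.pair.irreducible hq.q_ne_zero
    hq.a_ne_zero hq2 ha2 (fun _ => rfl) hk hβ⟩
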